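/- For integers $d\ge 1$ and $k\ge 1$, a $d$-multitournament of size $k$ is a loopless directed graph on the vertex set $\{1,\dots,k\}$ in which any two distinct vertices $i,j$ are joined by exactly $d$ directed edges: $l$ indistinguishable edges from $i$ to $j$ and $d-l$ indistinguishable edges from $j$ to $i$, for some $0\le l\le d$ that may vary from pair to pair. It is reducible if its vertices can be partitioned into two nonempty parts $A$ and $B$ such that, for all $a\in A$ and $b\in B$, all $d$ edges joining $a$ and $b$ go from $a$ to $b$; otherwise it is irreducible. Let $\mathfrak{it}_k(d)$ be the number of irreducible $d$-multitournaments of size $k$. An oriented graph on $\{1,\dots,n\}$ is a loopless directed graph with at most one directed edge between any two distinct vertices; it is weakly connected if the underlying undirected graph is connected. **Corollary.** Let $p_n$ be the probability that a uniformly random labeled oriented graph on the vertex set $\{1,\dots,n\}$ is weakly connected. Then $$p_n \approx 1-\sum_{k\ge 1}\mathfrak{it}_k(2)\cdot\binom nk\cdot\frac{3^{k(k+1)/2}}{3^{kn}}$$ as an asymptotic expansion for $n\to\infty$. That is, with $f_0(n)=1$ and $f_k(n)=-\,\mathfrak{it}_k(2)\binom nk 3^{k(k+1)/2}/3^{kn}$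 for $k\ge 1$, we have for every $r\ge 0$ $$p_n=\sum_{k=0}^{r}f_k(n)+O\big(f_{r+1}(n)\big)\qquad(n\to\infty),$$ and for every $k\ge 0$, $f_{k+1}(n)=o\big(f_k(n)\big)$ as $n\to\infty$. -/

import Mathlib

/-- The asymptotic expansion `a_n ≈ ∑_{k ≥ m} f_k(n)` as `n → ∞`: for every `r ≥ m`,
`a_n = ∑_{k=m}^{r} f_k(n) + O(f_{r+1}(n))`, and `f_{k+1}(n) = o(f_k(n))` for every `k ≥ m`. -/
def HasAsymptoticExpansion (a : ℕ → ℝ) (m : ℕ) (f : ℕ → ℕ → ℝ) : Prop :=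
  (∀ r, m ≤ r →
    (fun n => a n - ∑ k ∈ Finset.Icc m r, f k n) =O[Filter.atTop] (f (r + 1))) ∧
  (∀ k, m ≤ k → (f (k + 1)) =o[Filter.atTop] (f k))

/-- A `d`-multitournament with vertex set `V`: any two distinct vertices `i`, `j` are joined by
exactly `d` directed edges, `mult i j` indistinguishable ones from `i` to `j` and `mult j i`
indistinguishable ones from `j` to `i`. There are no loops. -/
@[ext]
structure MultiTournament (d : ℕ) (V : Type*) where
  mult : V → V → ℕ
  mult_self : ∀ i, mult i i = 0
  mult_add : ∀ i j, i ≠ j → mult i j + mult j i = d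

namespace MultiTournament

/-- There are finitely many `d`-multitournaments on a finite vertex set. -/
instance instFinite (d : ℕ) (V : Type*) [Finite V] : Finite (MultiTournament d V) := by
  have hle : ∀ (T : MultiTournament d V) (i j : V), T.mult i j < d + 1 := by
    intro T i j
    by_cases h : i = j
    · subst h
      rw [T.mult_self]
      omega
    · have := T.mult_add i j h
      omega
  refine Finite.of_injective
    (fun T : MultiTournament d V => fun (i j : V) => (⟨T.mult i j, hle T i j⟩ : Fin (d + 1))) ?_
  intro S T h
  ext i j
  exact congrArg Fin.val (congrFun (congrFun h i) j)

/-- `T` is reducible if its vertices can be partitioned into two nonempty parts `A` and `B = Aᶜ`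
such that for all `a ∈ A` and `b ∈ B`, all `d` edges joining `a` and `b` go from `a` to `b`. -/
def IsReducible {d : ℕ} {V : Type*} (T : MultiTournament d V) : Prop :=
  ∃ A : Set V, A.Nonempty ∧ Aᶜ.Nonempty ∧ ∀ a ∈ A, ∀ b ∈ Aᶜ, T.mult a b = d

/-- A `d`-multitournament is irreducible if it is not reducible. -/
def IsIrreducible {d : ℕ} {V : Type*} (T : MultiTournament d V) : Prop :=
  ¬ T.IsReducible

/-- The number `it_k(d)` of irreducible (labeled) `d`-multitournaments of size `k`. -/
noncomputable def irreducibleCount (d k : ℕ) : ℕ :=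
  Nat.card {T : MultiTournament d (Fin k) // T.IsIrreducible}

end MultiTournament

/-- An oriented graph with vertex set `V`: a digraph without loops and with at most one directed
edge between any two distinct vertices. -/
structure OrientedGraph (V : Type*) extends Digraph V where
  loopless : ∀ u, ¬ Adj u u
  asymm : ∀ u v, u ≠ v → ¬ (Adj u v ∧ Adj v u)

namespace OrientedGraph

/-- There are finitely many oriented graphs on a finite vertex set. -/
instance instFinite (V : Type*) [Finite V] : Finite (OrientedGraph V) := by
  refine Finite.of_injective (fun G : OrientedGraph V => G.Adj) ?_
  rintro ⟨⟨G⟩, _, _⟩ ⟨⟨H⟩, _, _⟩ h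
  cases h
  rfl

/-- An oriented graph is weakly connected if the simple graph obtained by forgetting the
directions of its edges is connected. -/
def IsWeaklyConnected {V : Type*} (G : OrientedGraph V) : Prop :=
  G.toDigraph.toSimpleGraphInclusive.Connected

/-- The probability that a uniformly random labeled oriented graph with `n` vertices is weakly
connected. -/
noncomputable def probWeaklyConnected (n : ℕ) : ℝ :=
  (Nat.card {G : OrientedGraph (Fin n) // G.IsWeaklyConnected} : ℝ) /
    (Nat.card (OrientedGraph (Fin n)) : ℝ)

end OrientedGraph

/-! Oriented graphs are 2-multitournaments (nonadjacency being a pair of opposite edges), so both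
are counted by `G(z) = ∑ 3^(n choose 2) zⁿ/n!`. With `IsSplit c`, one decomposition yields two
identities. For `c = d`, the minimal nonempty split set is an irreducible initial part, so `G = 1 +
I·G` and `1/G = 1 - I`, where `I` counts irreducible multitournaments of positive size. For `c = 1`,
`d = 2`, the minimal split set containing a vertex is its weak component, so `zC'·G = zG'`: up to
its constant term, `C = log G`. The coefficients `γ n` of `G` grow so fast that only the two ends of
a convolution matter. Since `log` has derivative `1/G` at `G`, this gives `κ n ≈ ∑ β s γ (n - s)`,
where `κ`, `β` are the coefficients of `C` and `1/G` (`exists_error_le`). Dividing by `γ n` turns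
the summands into the terms of the expansion (`expansionTerm_eq`). -/

namespace MultiTournament

/-! ### Split sets and indecomposability -/

variable {d : ℕ} {V W : Type*}

theorem mult_le (T : MultiTournament d V) (i j : V) : T.mult i j ≤ d := by
  by_cases h : i = j
  · subst h
    simp [T.mult_self]
  · have := T.mult_add i j h
    omega

/-- The multitournament induced along an injection of vertex sets. -/
def comap (f : V → W) (hf : Function.Injective f) (T : MultiTournament d W) :
    MultiTournament d V where
  mult i j := T.mult (f i) (f j)
  mult_self _ := T.mult_self _
  mult_add _ _ h := T.mult_add _ _ (hf.ne h)

/-- Relabelling of the vertices. -/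
def relabel (e : V ≃ W) : MultiTournament d V ≃ MultiTournament d W where
  toFun T := T.comap e.symm e.symm.injective
  invFun T := T.comap e e.injective
  left_inv T := by ext; simp [comap]
  right_inv T := by ext; simp [comap]

/-- The multitournament induced on a set of vertices. -/
abbrev induce (A : Set V) (T : MultiTournament d V) : MultiTournament d A :=
  T.comap Subtype.val Subtype.val_injective

/-- Exactly `c` edges go from any vertex of `A` to any vertex outside of `A`. -/
def IsSplit (c : ℕ) (T : MultiTournament d V) (A : Set V) : Prop :=
  ∀ a ∈ A, ∀ b ∈ Aᶜ, T.mult a b = c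

/-- Only trivial sets of vertices are split off with constant multiplicity `c`. -/
def IsIndecomposable (c : ℕ) (T : MultiTournament d V) : Prop :=
  ∀ A : Set V, A.Nonempty → T.IsSplit c A → A = Set.univ

theorem isIrreducible_iff_isIndecomposable (T : MultiTournament d V) :
    T.IsIrreducible ↔ T.IsIndecomposable d := by
  unfold IsIrreducible IsReducible IsIndecomposable IsSplit
  push Not
  refine forall_congr' fun A => forall_congr' fun _ => ?_
  rw [Set.nonempty_compl]
  constructor
  · intro h hs
    by_contra hA
    obtain ⟨a, ha, b, hb, hab⟩ := h hA
    exact hab (hs a ha b hb)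
  · intro h hA
    by_contra hs
    push Not at hs
    exact hA (h hs)

theorem isIndecomposable_relabel {c : ℕ} (e : V ≃ W) (T : MultiTournament d V) :
    (relabel e T).IsIndecomposable c ↔ T.IsIndecomposable c := by
  constructor
  · intro h A hA hs
    have := h (e '' A) (hA.image e) (by
      rintro _ ⟨a, ha, rfl⟩ b hb
      simp only [relabel, comap, Equiv.coe_fn_mk, Equiv.symm_apply_apply]
      refine hs a ha _ fun hb' => hb ⟨_, hb', by simp⟩)
    rw [Set.image_eq_iff_surjOn_mapsTo] at this
    ext x
    obtain ⟨y, hy, hxy⟩ := this.1 (Set.mem_univ (e x))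
    simpa using e.injective hxy ▸ hy
  · intro h A hA hs
    have := h (e ⁻¹' A) (hA.preimage e.surjective) (by
      intro a ha b hb
      have := hs (e a) ha (e b) hb
      simpa [relabel, comap] using this)
    ext x
    have hx : e.symm x ∈ e ⁻¹' A := this ▸ Set.mem_univ _
    simpa using hx

/-! ### Counting multitournaments and splittings -/

/-- The number of `c`-indecomposable `d`-multitournaments of size `k`. -/
noncomputable def indecomposableCount (c d k : ℕ) : ℕ :=
  Nat.card {T : MultiTournament d (Fin k) // T.IsIndecomposable c}

theorem irreducibleCount_eq_indecomposableCount (d k : ℕ) :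
    irreducibleCount d k = indecomposableCount d d k :=
  Nat.card_congr (Equiv.subtypeEquivRight fun T => T.isIrreducible_iff_isIndecomposable)

theorem card_isIndecomposable [Finite V] (c : ℕ) :
    Nat.card {T : MultiTournament d V // T.IsIndecomposable c} =
      indecomposableCount c d (Nat.card V) :=
  Nat.card_congr ((relabel (Finite.equivFin V)).subtypeEquiv fun T =>
    (isIndecomposable_relabel _ T).symm)

/-- A multitournament on `Fin n` is determined by its multiplicities from smaller to larger
vertices. -/
def equivFun (d n : ℕ) : MultiTournament d (Fin n) ≃ ((Σ j : Fin n, Fin j) → Fin (d + 1)) where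
  toFun T p := ⟨T.mult (Fin.castLT p.2 (p.2.2.trans p.1.2)) p.1, Nat.lt_succ_of_le (T.mult_le _ _)⟩
  invFun f :=
    { mult i j :=
        if h : i < j then f ⟨j, ⟨i, h⟩⟩ else if h : j < i then d - f ⟨i, ⟨j, h⟩⟩ else 0
      mult_self i := by simp
      mult_add i j hij := by
        rcases lt_or_gt_of_ne hij with h | h
        · have := (f ⟨j, ⟨i, h⟩⟩).2
          simp only [h, h.not_gt, dite_true, dite_false]
          omega
        · have := (f ⟨i, ⟨j, h⟩⟩).2
          simp only [h, h.not_gt, dite_true, dite_false]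
          omega }
  left_inv T := by
    ext i j
    rcases lt_trichotomy i j with h | rfl | h
    · simp [h, Fin.castLT]
    · simp [T.mult_self]
    · have := T.mult_add i j h.ne'
      simp only [h, h.not_gt, dite_true, dite_false, Fin.castLT, Fin.eta]
      omega
  right_inv f := by
    ext ⟨j, i⟩
    have h : Fin.castLT i (i.2.trans j.2) < j := i.2
    simp [h]

theorem card_eq (d : ℕ) (V : Type*) [Finite V] :
    Nat.card (MultiTournament d V) = (d + 1) ^ (Nat.card V).choose 2 := by
  rw [Nat.card_congr (relabel (Finite.equivFin V)), Nat.card_congr (equivFun d _)]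
  simp [Finset.sum_range_id, Fin.sum_univ_eq_sum_range (fun i => i), Nat.choose_two_right]

/-- Two multitournaments on complementary sets, joined with constant multiplicity `c`. -/
noncomputable def glue {c : ℕ} (hc : c ≤ d) (A : Set V) (S : MultiTournament d A)
    (T : MultiTournament d ↥Aᶜ) : MultiTournament d V := by
  classical
  exact
  { mult i j :=
      if hi : i ∈ A then if hj : j ∈ A then S.mult ⟨i, hi⟩ ⟨j, hj⟩ else c
      else if hj : j ∈ A then d - c else T.mult ⟨i, hi⟩ ⟨j, hj⟩
    mult_self i := by
      by_cases hi : i ∈ A <;> simp [hi, S.mult_self, T.mult_self]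
    mult_add i j hij := by
      by_cases hi : i ∈ A <;> by_cases hj : j ∈ A <;> simp only [hi, hj, dite_true, dite_false]
      · exact S.mult_add _ _ (by simpa using hij)
      · omega
      · omega
      · exact T.mult_add _ _ (by simpa using hij) }

/-- Splitting a multitournament along a set. -/
noncomputable def splitEquiv {c : ℕ} (hc : c ≤ d) (A : Set V) :
    {T : MultiTournament d V // T.IsSplit c A} ≃ MultiTournament d A × MultiTournament d ↥Aᶜ where
  toFun T := (T.1.induce A, T.1.induce Aᶜ)
  invFun p := ⟨glue hc A p.1 p.2, by
    intro a ha b hb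
    have hb' : b ∉ A := hb
    simp [glue, ha, hb']⟩
  left_inv := by
    rintro ⟨T, hT⟩
    ext i j
    by_cases hi : i ∈ A <;> by_cases hj : j ∈ A <;> simp [glue, hi, hj, comap]
    · exact (hT i hi j hj).symm
    · have h := hT j hj i hi
      have := T.mult_add i j (by rintro rfl; exact hi hj)
      omega
  right_inv := by
    rintro ⟨S, T⟩
    ext i j
    · simp [glue, comap]
    · have hi : i.1 ∉ A := i.2
      have hj : j.1 ∉ A := j.2
      simp [glue, comap, hi, hj]

theorem card_isSplit_isIndecomposable [Finite V] {c : ℕ} (hc : c ≤ d) (A : Set V) :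
    Nat.card {T : MultiTournament d V // T.IsSplit c A ∧ (T.induce A).IsIndecomposable c} =
      indecomposableCount c d (Nat.card A) * (d + 1) ^ (Nat.card ↥Aᶜ).choose 2 := by
  rw [← card_isIndecomposable, ← card_eq, ← Nat.card_prod]
  refine Nat.card_congr ((Equiv.subtypeSubtypeEquivSubtypeInter _ _).symm.trans
    (((splitEquiv hc A).subtypeEquiv (q := fun p => p.1.IsIndecomposable c)
      fun T => Iff.rfl).trans ?_))
  exact
    { toFun p := (⟨p.1.1, p.2⟩, p.1.2)
      invFun p := ⟨(p.1.1, p.2), p.1.2⟩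
      left_inv _ := rfl
      right_inv _ := rfl }

/-! ### Minimal split sets and the two counting identities -/

theorem IsSplit.of_induce {c : ℕ} {T : MultiTournament d V} {A : Set V} (hA : T.IsSplit c A)
    {B : Set A} (hB : (T.induce A).IsSplit c B) : T.IsSplit c (Subtype.val '' B) := by
  rintro _ ⟨a, ha, rfl⟩ b hb
  by_cases hbA : b ∈ A
  · exact hB a ha ⟨b, hbA⟩ fun h => hb ⟨_, h, rfl⟩
  · exact hA a a.2 b hbA

/-- The trace of `B` on `A` is a nonempty split set of the indecomposable `T.induce A`, hence all of
`A`. -/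
theorem IsSplit.subset_of_isIndecomposable {c : ℕ} {T : MultiTournament d V} {A B : Set V}
    (hB : T.IsSplit c B) (hA : (T.induce A).IsIndecomposable c) (h : (A ∩ B).Nonempty) :
    A ⊆ B := by
  obtain ⟨x, hxA, hxB⟩ := h
  have := hA (Subtype.val ⁻¹' B) ⟨⟨x, hxA⟩, hxB⟩ fun a ha b hb => hB a ha b hb
  intro y hy
  exact this.ge (Set.mem_univ (⟨y, hy⟩ : A))

/-- A minimal split set with `P` works: `hstep` turns a proper split subset into a smaller one with
`P`. Two solutions meet by `hinter`, so each contains the other. -/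
theorem existsUnique_isSplit_isIndecomposable [Finite V] {c : ℕ} (T : MultiTournament d V)
    (P : Set V → Prop) (huniv : P Set.univ)
    (hinter : ∀ A B, P A → P B → T.IsSplit c A → T.IsSplit c B → (A ∩ B).Nonempty)
    (hstep : ∀ A B, P A → T.IsSplit c A → T.IsSplit c B → B.Nonempty → B ⊂ A →
      ∃ B', P B' ∧ T.IsSplit c B' ∧ B' ⊂ A) :
    ∃! A : Set V, P A ∧ T.IsSplit c A ∧ (T.induce A).IsIndecomposable c := by
  obtain ⟨A, hA⟩ := (Set.toFinite {A | P A ∧ T.IsSplit c A}).exists_minimal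
    ⟨Set.univ, huniv, fun a _ b hb => absurd (Set.mem_univ b) hb⟩
  have hind : (T.induce A).IsIndecomposable c := by
    intro B hB hs
    by_contra hne
    obtain ⟨B', hP, hs', hlt⟩ := hstep A (Subtype.val '' B) hA.prop.1 hA.prop.2
      (hA.prop.2.of_induce hs) (hB.image _) (by
        refine (Set.ssubset_iff_subset_ne).2 ⟨by simp, fun h => hne ?_⟩
        ext x
        have : x.1 ∈ Subtype.val '' B := h.symm ▸ x.2
        simpa using this)
    exact hA.not_prop_of_lt hlt ⟨hP, hs'⟩
  refine ⟨A, ⟨hA.prop.1, hA.prop.2, hind⟩, fun B hB => ?_⟩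
  exact Set.Subset.antisymm
    (hA.prop.2.subset_of_isIndecomposable hB.2.2 (hinter _ _ hB.1 hA.prop.1 hB.2.1 hA.prop.2))
    (hB.2.1.subset_of_isIndecomposable hind (hinter _ _ hA.prop.1 hB.1 hA.prop.2 hB.2.1))

-- Multitournaments are sorted by their distinguished set `A`; those with a given `A` are free
-- outside `A`.
open Classical in
theorem card_eq_sum [Fintype V] {c : ℕ} (hc : c ≤ d) (P : Set V → Prop)
    (h : ∀ T : MultiTournament d V,
      ∃! A : Set V, P A ∧ T.IsSplit c A ∧ (T.induce A).IsIndecomposable c) :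
    (d + 1) ^ (Fintype.card V).choose 2 = ∑ A : Finset V, if P A then
      indecomposableCount c d A.card * (d + 1) ^ (Fintype.card V - A.card).choose 2 else 0 := by
  choose F hF hF' using h
  rw [← Nat.card_eq_fintype_card, ← card_eq, Nat.card_congr (Equiv.sigmaFiberEquiv F).symm,
    Nat.card_sigma, ← Equiv.sum_comp (Fintype.finsetEquivSet)]
  refine Finset.sum_congr rfl fun A _ => ?_
  split_ifs with hA
  · have := card_isSplit_isIndecomposable hc (A : Set V)
    rw [Nat.card_congr (Equiv.subtypeEquivRight (q := fun T : MultiTournament d V =>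
      T.IsSplit c A ∧ (T.induce (A : Set V)).IsIndecomposable c) fun T =>
        ⟨fun e => ?_, fun e => ?_⟩), this]
    · congr
      · simp
      · rw [← Finset.coe_compl]
        simp only [Finset.coe_sort_coe, Nat.card_eq_fintype_card, Fintype.card_coe,
          Finset.card_compl]
    · have e' : F T = A := by simpa using e
      rw [← e']
      exact (hF T).2
    · simpa using (hF' T A ⟨hA, e⟩).symm
  · rw [Nat.card_eq_zero]
    refine Or.inl ⟨fun T => hA ?_⟩
    have e : F T.1 = A := by simpa using T.2
    exact e ▸ (hF T.1).1

/-- Coefficient form of `G = 1 + I·G`. Disjoint nonempty split sets would force `d + d = d`. The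
case `k = 0` is excluded by hand because the empty multitournament counts as irreducible. -/
theorem pow_choose_two_eq_sum_irreducibleCount {d : ℕ} (hd : d ≠ 0) (n : ℕ) (hn : n ≠ 0) :
    (d + 1) ^ n.choose 2 = ∑ k ∈ Finset.range (n + 1), n.choose k *
      ((if k = 0 then 0 else irreducibleCount d k) * (d + 1) ^ (n - k).choose 2) := by
  classical
  have : NeZero n := ⟨hn⟩
  have h := card_eq_sum (V := Fin n) (le_refl d) Set.Nonempty fun T =>
    existsUnique_isSplit_isIndecomposable T _ Set.univ_nonempty
      (fun A B hA hB hsA hsB => by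
        by_contra hAB
        rw [Set.not_nonempty_iff_eq_empty, ← Set.disjoint_iff_inter_eq_empty] at hAB
        obtain ⟨a, ha⟩ := hA
        obtain ⟨b, hb⟩ := hB
        have hbA : b ∈ Aᶜ := fun h => hAB.ne_of_mem h hb rfl
        have haB : a ∈ Bᶜ := fun h => hAB.ne_of_mem ha h rfl
        have h1 := hsA a ha b hbA
        have h2 := hsB b hb a haB
        have := T.mult_add a b (hAB.ne_of_mem ha hb)
        omega)
      (fun A B _ _ hsB hB hBA => ⟨B, hB, hsB, hBA⟩)
  simp only [Fintype.card_fin, Finset.coe_nonempty] at h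
  rw [h]
  have := Finset.sum_powerset_apply_card (fun k =>
    (if k = 0 then 0 else irreducibleCount d k) * (d + 1) ^ (n - k).choose 2)
    (x := (Finset.univ : Finset (Fin n)))
  simp only [Finset.card_univ, Fintype.card_fin, smul_eq_mul, Finset.powerset_univ] at this
  rw [← this]
  refine Finset.sum_congr rfl fun A _ => ?_
  rcases A.eq_empty_or_nonempty with rfl | hA
  · simp
  · simp [hA, hA.ne_empty, irreducibleCount_eq_indecomposableCount]

theorem IsSplit.compl {c : ℕ} {T : MultiTournament (2 * c) V} {A : Set V} (h : T.IsSplit c A) :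
    T.IsSplit c Aᶜ := by
  intro a ha b hb
  rw [compl_compl] at hb
  have h1 := h b hb a ha
  have := T.mult_add a b (by rintro rfl; exact ha hb)
  omega

theorem IsSplit.inter {c : ℕ} {T : MultiTournament (2 * c) V} {A B : Set V} (hA : T.IsSplit c A)
    (hB : T.IsSplit c B) : T.IsSplit c (A ∩ B) := by
  intro a ha b hb
  by_cases h : b ∈ A
  · exact hB a ha.2 b fun h' => hb ⟨h, h'⟩
  · exact hA a ha.1 b h

/-- Coefficient form of `zG' = zC'·G`, by counting pairs of a multitournament and a root `v`. For `d
= 2c` split sets are closed under complements and intersections, so either `B` or `A ∩ Bᶜ` keeps the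
root. -/
theorem mul_pow_choose_two_eq_sum_indecomposableCount (c n : ℕ) :
    n * (2 * c + 1) ^ n.choose 2 = ∑ k ∈ Finset.range (n + 1), n.choose k *
      (k * indecomposableCount c (2 * c) k * (2 * c + 1) ^ (n - k).choose 2) := by
  classical
  have h (v : Fin n) := card_eq_sum (V := Fin n) (show c ≤ 2 * c by omega) (fun A => v ∈ A)
    fun T => existsUnique_isSplit_isIndecomposable T _ (Set.mem_univ v)
      (fun A B hA hB _ _ => ⟨v, hA, hB⟩)
      (fun A B hvA hsA hsB hB hBA => by
        by_cases hv : v ∈ B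
        · exact ⟨B, hv, hsB, hBA⟩
        · refine ⟨A ∩ Bᶜ, ⟨hvA, hv⟩, hsA.inter hsB.compl, Set.inter_subset_left, fun h => ?_⟩
          obtain ⟨x, hx⟩ := hB
          exact (h (hBA.1 hx)).2 hx)
  have h := Finset.sum_congr (rfl : (Finset.univ : Finset (Fin n)) = _) fun v _ => h v
  rw [Finset.sum_comm] at h
  simp only [Fintype.card_fin, Finset.sum_const, Finset.card_univ, smul_eq_mul,
    Finset.mem_coe] at h
  rw [h]
  have := Finset.sum_powerset_apply_card (fun k =>
    k * indecomposableCount c (2 * c) k * (2 * c + 1) ^ (n - k).choose 2)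
    (x := (Finset.univ : Finset (Fin n)))
  simp only [Finset.card_univ, Fintype.card_fin, smul_eq_mul, Finset.powerset_univ] at this
  rw [← this]
  refine Finset.sum_congr rfl fun A _ => ?_
  simp [mul_assoc]

theorem indecomposableCount_le (c d k : ℕ) :
    indecomposableCount c d k ≤ (d + 1) ^ k.choose 2 := by
  have h := card_eq d (Fin k)
  rw [Nat.card_fin] at h
  rw [← h]
  exact Nat.card_le_card_of_injective _ Subtype.val_injective

/-- Makes every term of the expansion eventually nonzero, so that it can serve as an error bound.
The witness has all multiplicities 1, the edgeless oriented graph. -/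
theorem irreducibleCount_two_pos (k : ℕ) : 0 < irreducibleCount 2 k := by
  classical
  rw [irreducibleCount_eq_indecomposableCount, indecomposableCount, Nat.card_pos_iff]
  refine ⟨⟨⟨⟨fun i j => if i = j then 0 else 1, by simp, fun i j h => by simp [h, h.symm]⟩, ?_⟩⟩,
    inferInstance⟩
  rintro A ⟨a, ha⟩ hs
  by_contra hA
  obtain ⟨b, hb⟩ := (Set.ne_univ_iff_exists_notMem _).1 hA
  have := hs a ha b hb
  simp only at this
  split_ifs at this
  omega

end MultiTournament

/-! ### Oriented graphs as 2-multitournaments -/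

namespace OrientedGraph

variable {V : Type*}

open Classical in
/-- Oriented graphs are `2`-multitournaments: an edge corresponds to a double edge, and
nonadjacency to a pair of opposite edges. -/
noncomputable def equivMultiTournament (V : Type*) : OrientedGraph V ≃ MultiTournament 2 V where
  toFun G :=
    { mult i j := if G.Adj i j then 2 else if i = j ∨ G.Adj j i then 0 else 1
      mult_self i := by simp [G.loopless]
      mult_add i j h := by
        have := G.asymm i j h
        by_cases h1 : G.Adj i j <;> by_cases h2 : G.Adj j i <;> simp_all [h.symm] }
  invFun T :=
    { Adj i j := T.mult i j = 2
      loopless i := by simp [T.mult_self]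
      asymm i j h := by
        have := T.mult_add i j h
        omega }
  left_inv := by
    rintro ⟨⟨G⟩, h1, h2⟩
    simp only [OrientedGraph.mk.injEq, Digraph.mk.injEq]
    ext i j
    split_ifs <;> simp_all
  right_inv T := by
    ext i j
    rcases eq_or_ne i j with rfl | h
    · simp [T.mult_self]
    · have := T.mult_add i j h
      dsimp only
      split_ifs <;> simp_all
      omega

/-- Multiplicity 1 means nonadjacency, so the split sets for `c = 1` are the unions of components.
-/
theorem isWeaklyConnected_iff [Nonempty V] (G : OrientedGraph V) :
    G.IsWeaklyConnected ↔ (equivMultiTournament V G).IsIndecomposable 1 := by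
  have hadj (i j : V) : G.toDigraph.toSimpleGraphInclusive.Adj i j ↔
      i ≠ j ∧ (equivMultiTournament V G).mult i j ≠ 1 := by
    by_cases h1 : G.Adj i j <;> by_cases h2 : G.Adj j i <;> by_cases h3 : i = j <;>
      simp [equivMultiTournament, Digraph.toSimpleGraphInclusive, h1, h2, h3]
  unfold IsWeaklyConnected
  constructor
  · rintro hG A ⟨a, ha⟩ hs
    ext b
    simp only [Set.mem_univ, iff_true]
    obtain ⟨p⟩ := hG.preconnected a b
    induction p with
    | nil => exact ha
    | @cons u v w huv p ih =>
      refine ih ?_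
      by_contra hv
      exact ((hadj _ _).1 huv).2 (hs _ ha _ hv)
  · intro h
    obtain ⟨v⟩ := ‹Nonempty V›
    have hr := h {w | G.toDigraph.toSimpleGraphInclusive.Reachable v w}
      ⟨v, SimpleGraph.Reachable.refl v⟩ (by
        intro a ha b hb
        by_contra hab
        refine hb (SimpleGraph.Reachable.trans ha (SimpleGraph.Adj.reachable ((hadj _ _).2
          ⟨?_, hab⟩)))
        rintro rfl
        exact hb ha)
    rw [SimpleGraph.connected_iff_exists_forall_reachable]
    exact ⟨v, fun w => hr.ge (Set.mem_univ w)⟩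

theorem probWeaklyConnected_eq {n : ℕ} (hn : n ≠ 0) :
    probWeaklyConnected n =
      MultiTournament.indecomposableCount 1 2 n / (3 : ℝ) ^ n.choose 2 := by
  have : NeZero n := ⟨hn⟩
  have h := MultiTournament.card_eq 2 (Fin n)
  rw [Nat.card_fin] at h
  rw [probWeaklyConnected, Nat.card_congr (equivMultiTournament (Fin n)), h,
    MultiTournament.indecomposableCount,
    Nat.card_congr ((equivMultiTournament (Fin n)).subtypeEquiv isWeaklyConnected_iff)]
  norm_num

end OrientedGraph

/-! ### Transfer from `G` to `log G` -/

open Finset PowerSeries in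
/-- The coefficientwise form of `zC' = zG' · G⁻¹`, given `zC' · G = zG'`. -/
theorem sum_antidiagonal_mul_eq_of_inverse {R : Type*} [CommRing R] {a b c e : ℕ → R}
    (hab : ∀ n, ∑ p ∈ antidiagonal n, a p.1 * b p.2 = if n = 0 then 1 else 0)
    (hca : ∀ n, ∑ p ∈ antidiagonal n, c p.1 * a p.2 = e n) (n : ℕ) :
    ∑ p ∈ antidiagonal n, e p.1 * b p.2 = c n := by
  have h1 : PowerSeries.mk a * PowerSeries.mk b = 1 := by
    ext n
    simp [coeff_mul, hab, coeff_one]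
  have h2 : PowerSeries.mk c * PowerSeries.mk a = PowerSeries.mk e := by
    ext n
    simp [coeff_mul, hca]
  have h3 : PowerSeries.mk e * PowerSeries.mk b = PowerSeries.mk c := by
    rw [← h2, mul_assoc, h1, mul_one]
  simpa [coeff_mul] using congrArg (coeff n) h3

namespace LogarithmicExpansion

open Finset

/-- The error of the `r`-term approximation of the sequence `κ`. -/
def error (γ κ β : ℕ → ℝ) (r n : ℕ) : ℝ :=
  κ n - ∑ s ∈ range (r + 1), β s * γ (n - s)

variable {γ κ β : ℕ → ℝ}

/-- In `zC'·G = zG'`, the `κ (n - k)` with `k ≤ r` are replaced by their approximations of order `r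
- k`. These main terms cancel `n γ n` against the opposite end of the convolution; only the middle
range survives. -/
theorem sum_mul_error
    (hβ : ∀ n, ∑ p ∈ antidiagonal n, γ p.1 * β p.2 = if n = 0 then 1 else 0)
    (hκ : ∀ n : ℕ, ∑ p ∈ antidiagonal n, (p.1 * κ p.1) * γ p.2 = n * γ n) {r n : ℕ}
    (hn : 2 * r + 2 ≤ n) :
    ∑ k ∈ range (r + 1), γ k * ((n - k : ℕ) * error γ κ β (r - k) (n - k)) =
      -∑ j ∈ Ico (r + 1) (n - r), γ j * ((n - j : ℕ) * κ (n - j)) := by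
  have hβκ := sum_antidiagonal_mul_eq_of_inverse (c := fun n => n * κ n)
    (e := fun n => n * γ n) hβ hκ
  -- the contribution of the main terms
  have h1 : ∑ k ∈ range (r + 1), γ k * ((n - k : ℕ) *
        ∑ s ∈ range (r - k + 1), β s * γ (n - k - s)) =
      n * γ n - ∑ s ∈ range (r + 1), s * κ s * γ (n - s) := by
    calc _ = ∑ k ∈ range (r + 1), ∑ s ∈ range (r + 1 - k),
          γ k * β s * (n - k) * γ (n - (k + s)) := by
          refine sum_congr rfl fun k hk => ?_
          rw [mem_range] at hk
          rw [mul_sum, mul_sum, show r - k + 1 = r + 1 - k by omega]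
          refine sum_congr rfl fun s _ => ?_
          rw [Nat.cast_sub (by omega), Nat.sub_sub]
          ring
      _ = ∑ m ∈ range (r + 1), ∑ k ∈ range (m + 1),
          γ k * β (m - k) * (n - k) * γ (n - (k + (m - k))) :=
          (sum_range_diag_flip (r + 1) fun k s => γ k * β s * (n - k) * γ (n - (k + s))).symm
      _ = ∑ m ∈ range (r + 1), ((if m = 0 then n * γ n else 0) - m * κ m * γ (n - m)) := by
          refine sum_congr rfl fun m _ => ?_
          -- In the factor `n - k`, the part `n` produces the coefficient of `G · (1/G)` and the
          -- part `k` that of `zG'/G = zC'`.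
          have e1 := hβ m
          have e2 := hβκ m
          rw [Nat.sum_antidiagonal_eq_sum_range_succ_mk] at e1 e2
          rw [← e2, sum_mul, eq_sub_iff_add_eq, ← sum_add_distrib]
          trans (∑ k ∈ range (m + 1), γ k * β (m - k)) * (n * γ (n - m))
          · rw [sum_mul]
            refine sum_congr rfl fun k hk => ?_
            rw [mem_range] at hk
            rw [show k + (m - k) = m by omega]
            ring
          · rw [e1]
            split_ifs with h <;> simp [h]
      _ = _ := by
          rw [sum_sub_distrib]
          simp
  -- the contribution of `κ`
  have h2 : ∑ k ∈ range (r + 1), γ k * ((n - k : ℕ) * κ (n - k)) =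
      n * γ n - ∑ j ∈ Ico (r + 1) (n - r), γ j * ((n - j : ℕ) * κ (n - j))
        - ∑ s ∈ range (r + 1), s * κ s * γ (n - s) := by
    rw [← hκ n, ← Nat.sum_antidiagonal_swap, Nat.sum_antidiagonal_eq_sum_range_succ_mk,
      Nat.succ_eq_add_one, range_eq_Ico, range_eq_Ico, ← sum_Ico_consecutive _ (Nat.zero_le (r + 1)) (show r + 1 ≤ n + 1 by omega),
      ← sum_Ico_consecutive _ (show r + 1 ≤ n - r by omega) (show n - r ≤ n + 1 by omega)]
    have h3 : ∑ j ∈ Ico (n - r) (n + 1), ((n - j : ℕ) * κ (n - j)) * γ j =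
        ∑ s ∈ Ico 0 (r + 1), s * κ s * γ (n - s) := by
      have := sum_Ico_reflect (fun j => ((n - j : ℕ) * κ (n - j)) * γ j) 0
        (show r + 1 ≤ n + 1 by omega)
      rw [show n + 1 - (r + 1) = n - r by omega, Nat.sub_zero] at this
      rw [← this]
      refine sum_congr rfl fun s hs => ?_
      rw [mem_Ico] at hs
      rw [show n - (n - s) = s by omega]
    simp only [Prod.swap]
    rw [h3]
    simp only [mul_comm (γ _)]
    ring
  simp only [error, mul_sub, sum_sub_distrib]
  rw [h1, h2]
  ring

/-- If the two-sided tails of `γ * γ` are negligible, then the coefficients `κ` of `log G` satisfy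
`κ n ≈ ∑ β s γ (n - s)`, where `β` are the coefficients of `1 / G`. -/
theorem exists_error_le
    (hβ : ∀ n, ∑ p ∈ antidiagonal n, γ p.1 * β p.2 = if n = 0 then 1 else 0)
    (hκ : ∀ n : ℕ, ∑ p ∈ antidiagonal n, (p.1 * κ p.1) * γ p.2 = n * γ n)
    (hγ : ∀ n, 0 ≤ γ n) (hγ0 : γ 0 = 1) (hκγ : ∀ n, |κ n| ≤ γ n)
    (htail : ∀ r, ∃ K, ∀ n, 2 * r + 2 ≤ n →
      ∑ j ∈ Ico (r + 1) (n - r), γ j * γ (n - j) ≤ K * γ (n - r - 1)) (r : ℕ) :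
    ∃ K, ∀ n, 2 * r + 2 ≤ n → |error γ κ β r n| ≤ K * γ (n - r - 1) := by
  induction r using Nat.strong_induction_on with
  | _ r ih =>
  obtain ⟨K, hK⟩ := htail r
  choose! L hL using ih
  refine ⟨K + ∑ k ∈ range r, γ (k + 1) * L (r - (k + 1)), fun n hn => ?_⟩
  have hn0 : (0 : ℝ) < n := by
    have : 0 < n := by omega
    exact_mod_cast this
  have hsub (j : ℕ) : ((n - j : ℕ) : ℝ) ≤ n := by exact_mod_cast Nat.sub_le n j
  have h := sum_mul_error hβ hκ hn
  -- The summand `k = 0` is `n` times the wanted error; everything else is to be bounded.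
  rw [sum_range_succ', hγ0] at h
  simp only [Nat.sub_zero, one_mul] at h
  have htail' : |∑ j ∈ Ico (r + 1) (n - r), γ j * ((n - j : ℕ) * κ (n - j))| ≤
      n * (K * γ (n - r - 1)) := by
    refine (abs_sum_le_sum_abs _ _).trans ((sum_le_sum fun j _ => ?_).trans
      ((mul_sum _ _ _).symm.le.trans (mul_le_mul_of_nonneg_left (hK n hn) hn0.le)))
    rw [abs_mul, abs_mul, abs_of_nonneg (hγ j), Nat.abs_cast, mul_left_comm]
    exact mul_le_mul (hsub j) (mul_le_mul_of_nonneg_left (hκγ _) (hγ j))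
      (mul_nonneg (hγ j) (abs_nonneg _)) hn0.le
  have hmain : |∑ k ∈ range r, γ (k + 1) *
      ((n - (k + 1) : ℕ) * error γ κ β (r - (k + 1)) (n - (k + 1)))| ≤
      n * ((∑ k ∈ range r, γ (k + 1) * L (r - (k + 1))) * γ (n - r - 1)) := by
    rw [sum_mul, mul_sum]
    refine (abs_sum_le_sum_abs _ _).trans (sum_le_sum fun k hk => ?_)
    rw [mem_range] at hk
    have := hL (r - (k + 1)) (by omega) (n - (k + 1)) (by omega)
    -- Lowering `n` and `r` together keeps `n - r - 1`, so all errors are measured by the same `γ`.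
    rw [show n - (k + 1) - (r - (k + 1)) - 1 = n - r - 1 by omega] at this
    rw [abs_mul, abs_mul, abs_of_nonneg (hγ (k + 1)), Nat.abs_cast, mul_left_comm]
    rw [mul_assoc]
    exact mul_le_mul (hsub _) (mul_le_mul_of_nonneg_left this (hγ _))
      (mul_nonneg (hγ _) (abs_nonneg _)) hn0.le
  refine le_of_mul_le_mul_left ?_ hn0
  rw [← abs_of_pos hn0, ← abs_mul, abs_of_pos hn0, eq_sub_of_add_eq' h, add_mul, mul_add]
  refine (abs_sub _ _).trans ?_
  rw [abs_neg]
  exact add_le_add htail' hmain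

end LogarithmicExpansion

namespace OrientedGraph

/-! ### Growth of the coefficients -/

open Finset Filter Asymptotics MultiTournament

/-- The exponential generating function coefficients of `2`-multitournaments. -/
noncomputable def egfCoeff (n : ℕ) : ℝ := 3 ^ n.choose 2 / n.factorial

theorem egfCoeff_pos (n : ℕ) : 0 < egfCoeff n := by
  unfold egfCoeff
  positivity

theorem egfCoeff_succ (n : ℕ) : egfCoeff (n + 1) * (n + 1) = 3 ^ n * egfCoeff n := by
  have : (n.factorial : ℝ) ≠ 0 := by positivity
  rw [egfCoeff, egfCoeff, Nat.factorial_succ, Nat.choose_succ_succ', Nat.choose_one_right, pow_add]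
  push_cast
  field_simp

/-- The sequence `egfCoeff` is log-convex. -/
theorem egfCoeff_succ_mul_le {i j : ℕ} (h : i ≤ j) :
    egfCoeff (i + 1) * egfCoeff j ≤ egfCoeff i * egfCoeff (j + 1) := by
  -- The ratio `3 ^ i / (i + 1)` of consecutive coefficients is nondecreasing.
  have hmono : (3 : ℝ) ^ i * (j + 1) ≤ 3 ^ j * (i + 1) := by
    induction j, h using Nat.le_induction with
    | base => exact le_rfl
    | succ j hj ih =>
      push_cast
      have : (0 : ℝ) ≤ 3 ^ i * j := by positivity
      have : (0 : ℝ) < 3 ^ i := by positivity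
      rw [pow_succ]
      nlinarith
  have hi := egfCoeff_succ i
  have hj := egfCoeff_succ j
  have hij : 0 < ((i : ℝ) + 1) * (j + 1) := by positivity
  refine le_of_mul_le_mul_right ?_ hij
  have hp := mul_pos (egfCoeff_pos i) (egfCoeff_pos j)
  calc _ = (3 ^ i * (j + 1)) * (egfCoeff i * egfCoeff j) := by
          linear_combination egfCoeff j * (j + 1) * hi
    _ ≤ (3 ^ j * (i + 1)) * (egfCoeff i * egfCoeff j) := mul_le_mul_of_nonneg_right hmono hp.le
    _ = _ := by linear_combination -egfCoeff i * (i + 1) * hj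

theorem egfCoeff_mul_le {i j t : ℕ} (h : i + t ≤ j + 1) :
    egfCoeff (i + t) * egfCoeff j ≤ egfCoeff i * egfCoeff (j + t) := by
  induction t generalizing j with
  | zero => rfl
  | succ t ih =>
    calc egfCoeff (i + t + 1) * egfCoeff j ≤ egfCoeff (i + t) * egfCoeff (j + 1) :=
          egfCoeff_succ_mul_le (by omega)
      _ ≤ _ := by
          have := ih (j := j + 1) (by omega)
          rwa [show j + 1 + t = j + (t + 1) by omega] at this

theorem egfCoeff_mul_sub_le {n r j : ℕ} (h1 : r ≤ j) (h2 : j + r ≤ n) :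
    egfCoeff j * egfCoeff (n - j) ≤ egfCoeff r * egfCoeff (n - r) := by
  wlog h : j ≤ n - j generalizing j
  · have := this (j := n - j) (by omega) (by omega) (by omega)
    rwa [show n - (n - j) = j by omega, mul_comm] at this
  have := egfCoeff_mul_le (i := r) (j := n - j) (t := j - r) (by omega)
  rwa [show r + (j - r) = j by omega, show n - j + (j - r) = n - r by omega] at this

theorem exists_mul_le_three_pow (s : ℕ) :
    ∃ K : ℝ, 0 ≤ K ∧ ∀ m : ℕ, ((m + s : ℕ) : ℝ) * (m + 1) ≤ K * 3 ^ m := by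
  refine ⟨s + 2, by positivity, fun m => ?_⟩
  have h : ∀ m : ℕ, ((m : ℝ) + 1) ^ 2 ≤ 2 * 3 ^ m := by
    intro m
    induction m with
    | zero => norm_num
    | succ m ih =>
      rcases m with _ | m
      · norm_num
      · rw [pow_succ (3 : ℝ)]
        push_cast at *
        have : (0 : ℝ) ≤ m := by positivity
        nlinarith
  have h' : ∀ m : ℕ, (m : ℝ) + 1 ≤ 3 ^ m := by
    intro m
    have := one_add_mul_le_pow (show (-2 : ℝ) ≤ 2 by norm_num) m
    norm_num at this
    have hm : (0 : ℝ) ≤ m := by positivity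
    linarith
  have h1 := h m
  have h2 := mul_le_mul_of_nonneg_left (h' m) (show (0 : ℝ) ≤ s by positivity)
  have hm : (0 : ℝ) ≤ m := by positivity
  push_cast
  nlinarith

/-- The two end terms are `γ (r+1) γ (n-r-1)`. By log-convexity each of the fewer than `n` others is
at most `γ (r+2) γ (n-r-2)`, and the ratio of consecutive coefficients absorbs the factor `n`. -/
theorem egfCoeff_tail (r : ℕ) : ∃ K, ∀ n, 2 * r + 2 ≤ n →
    ∑ j ∈ Ico (r + 1) (n - r), egfCoeff j * egfCoeff (n - j) ≤ K * egfCoeff (n - r - 1) := by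
  obtain ⟨K, hK0, hK⟩ := exists_mul_le_three_pow (r + 2)
  refine ⟨2 * egfCoeff (r + 1) + egfCoeff (r + 2) * K, fun n hn => ?_⟩
  have hp := egfCoeff_pos
  -- For `n = 2r + 2` the two end terms coincide.
  rcases hn.eq_or_lt with rfl | hn
  · rw [show 2 * r + 2 - r = r + 1 + 1 by omega, Nat.Ico_succ_singleton, sum_singleton,
      show 2 * r + 2 - (r + 1) = r + 1 by omega, show r + 1 + 1 - 1 = r + 1 by omega]
    exact mul_le_mul_of_nonneg_right
      (by nlinarith [hp (r + 1), mul_nonneg (hp (r + 2)).le hK0]) (hp _).le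
  obtain ⟨m, rfl⟩ : ∃ m, n = m + (r + 2) := ⟨n - (r + 2), by omega⟩
  rw [show m + (r + 2) - r = m + 2 by omega, show m + 2 - 1 = m + 1 by omega,
    sum_Ico_succ_top (by omega), sum_eq_sum_Ico_succ_bot (by omega),
    show m + (r + 2) - (r + 1) = m + 1 by omega, show m + (r + 2) - (m + 1) = r + 1 by omega]
  have hmid : ∑ j ∈ Ico (r + 1 + 1) (m + 1), egfCoeff j * egfCoeff (m + (r + 2) - j) ≤
      egfCoeff (r + 2) * K * egfCoeff (m + 1) := by
    calc _ ≤ ∑ j ∈ Ico (r + 1 + 1) (m + 1), egfCoeff (r + 2) * egfCoeff m := by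
          refine sum_le_sum fun j hj => ?_
          rw [mem_Ico] at hj
          have := egfCoeff_mul_sub_le (n := m + (r + 2)) (r := r + 2) (j := j) (by omega) (by omega)
          rwa [Nat.add_sub_cancel] at this
      _ ≤ (m + (r + 2) : ℕ) * (egfCoeff (r + 2) * egfCoeff m) := by
          rw [sum_const, nsmul_eq_mul, Nat.card_Ico]
          refine mul_le_mul_of_nonneg_right ?_ (mul_pos (hp _) (hp _)).le
          exact_mod_cast (by omega)
      _ ≤ _ := by
          rw [mul_left_comm, mul_assoc]
          refine mul_le_mul_of_nonneg_left ?_ (hp _).le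
          have hm : (0 : ℝ) < m + 1 := by positivity
          refine le_of_mul_le_mul_right ?_ hm
          rw [mul_assoc K, egfCoeff_succ]
          have := mul_le_mul_of_nonneg_right (hK m) (hp m).le
          linarith
  linarith [mul_comm (egfCoeff (m + 1)) (egfCoeff (r + 1))]

/-! ### Coefficients of `1/G` and `log G` -/

/-- The coefficients of the inverse of the exponential generating function of
`2`-multitournaments. -/
noncomputable def invCoeff (k : ℕ) : ℝ :=
  if k = 0 then 1 else -((irreducibleCount 2 k : ℝ) / k.factorial)

/-- The exponential generating function coefficients of weakly connected oriented graphs. -/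
noncomputable def connCoeff (n : ℕ) : ℝ := indecomposableCount 1 2 n / n.factorial

theorem egfCoeff_mul_invCoeff (n : ℕ) :
    ∑ p ∈ antidiagonal n, egfCoeff p.1 * invCoeff p.2 = if n = 0 then 1 else 0 := by
  rcases eq_or_ne n 0 with rfl | hn
  · simp [egfCoeff, invCoeff]
  rw [if_neg hn, ← Nat.sum_antidiagonal_swap, Nat.sum_antidiagonal_eq_sum_range_succ_mk]
  have h := congrArg (Nat.cast : ℕ → ℝ) (pow_choose_two_eq_sum_irreducibleCount two_ne_zero n hn)
  rw [sum_range_succ'] at h ⊢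
  have h0 : (n.factorial : ℝ) ≠ 0 := by positivity
  push_cast at h
  simp only [zero_mul, mul_zero, add_zero] at h
  have h' : egfCoeff n = ∑ k ∈ range n,
      (irreducibleCount 2 (k + 1) : ℝ) / (k + 1).factorial * egfCoeff (n - (k + 1)) := by
    rw [egfCoeff, h, sum_div]
    refine sum_congr rfl fun k hk => ?_
    rw [mem_range] at hk
    rw [egfCoeff, Nat.cast_choose ℝ (show k + 1 ≤ n by omega)]
    have h1 : ((k + 1).factorial : ℝ) ≠ 0 := by positivity
    have h2 : ((n - (k + 1)).factorial : ℝ) ≠ 0 := by positivity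
    field_simp
  simp only [Prod.swap, invCoeff, Nat.add_eq_zero_iff, one_ne_zero, and_false, if_false, if_true,
    Nat.sub_zero, mul_one]
  rw [h', ← sum_add_distrib]
  exact sum_eq_zero fun k _ => by ring

theorem connCoeff_mul_egfCoeff (n : ℕ) :
    ∑ p ∈ antidiagonal n, (p.1 * connCoeff p.1) * egfCoeff p.2 = n * egfCoeff n := by
  rw [Nat.sum_antidiagonal_eq_sum_range_succ_mk]
  have h := congrArg (Nat.cast : ℕ → ℝ) (mul_pow_choose_two_eq_sum_indecomposableCount 1 n)
  norm_num at h
  have h0 : (n.factorial : ℝ) ≠ 0 := by positivity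
  rw [egfCoeff, ← mul_div_assoc, h, sum_div]
  refine sum_congr rfl fun k hk => ?_
  rw [mem_range] at hk
  rw [egfCoeff, connCoeff, Nat.cast_choose ℝ (show k ≤ n by omega)]
  have h1 : (k.factorial : ℝ) ≠ 0 := by positivity
  have h2 : ((n - k).factorial : ℝ) ≠ 0 := by positivity
  field_simp

theorem abs_connCoeff_le (n : ℕ) : |connCoeff n| ≤ egfCoeff n := by
  rw [connCoeff, egfCoeff, abs_of_nonneg (by positivity)]
  gcongr
  exact_mod_cast indecomposableCount_le 1 2 n

/-! ### The asymptotic expansion -/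

/-- The `k`-th term of the expansion. -/
noncomputable def expansionTerm (k n : ℕ) : ℝ :=
  if k = 0 then 1
  else -((irreducibleCount 2 k : ℝ) * (n.choose k : ℝ) *
    ((3 : ℝ) ^ (k * (k + 1) / 2) / (3 : ℝ) ^ (k * n)))

theorem choose_two_add {k n : ℕ} (h : k ≤ n) :
    (n - k).choose 2 + k * n = n.choose 2 + k * (k + 1) / 2 := by
  obtain ⟨m, rfl⟩ := Nat.exists_eq_add_of_le h
  rw [Nat.add_sub_cancel_left]
  induction k with
  | zero => simp
  | succ k ih =>
    have ih := ih (by omega)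
    have h1 : (k + 1 + m).choose 2 = (k + m) + (k + m).choose 2 := by
      rw [show k + 1 + m = k + m + 1 by omega, Nat.choose_succ_succ', Nat.choose_one_right]
    have h2 : (k + 1) * (k + 1 + 1) / 2 = k * (k + 1) / 2 + (k + 1) := by
      rw [show (k + 1) * (k + 1 + 1) = k * (k + 1) + (k + 1) * 2 by ring,
        Nat.add_mul_div_right _ _ two_pos]
    rw [h1, h2]
    nlinarith

theorem expansionTerm_eq {k n : ℕ} (h : k ≤ n) :
    expansionTerm k n = invCoeff k * egfCoeff (n - k) / egfCoeff n := by
  unfold expansionTerm invCoeff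
  split_ifs with hk
  · rw [hk, Nat.sub_zero, one_mul, div_self (egfCoeff_pos n).ne']
  · have h3 : (3 : ℝ) ^ (n - k).choose 2 * 3 ^ (k * n) =
        3 ^ n.choose 2 * 3 ^ (k * (k + 1) / 2) := by
      rw [← pow_add, ← pow_add, choose_two_add h]
    rw [egfCoeff, egfCoeff, Nat.cast_choose ℝ h]
    have h0 : (n.factorial : ℝ) ≠ 0 := by positivity
    have h1 : (k.factorial : ℝ) ≠ 0 := by positivity
    have h2 : ((n - k).factorial : ℝ) ≠ 0 := by positivity
    field_simp
    linear_combination (irreducibleCount 2 k : ℝ) * h3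

theorem invCoeff_ne_zero (k : ℕ) : invCoeff k ≠ 0 := by
  have := irreducibleCount_two_pos k
  unfold invCoeff
  split_ifs
  · exact one_ne_zero
  · exact neg_ne_zero.2 (by positivity)

theorem probWeaklyConnected_eq_div {n : ℕ} (hn : n ≠ 0) :
    probWeaklyConnected n = connCoeff n / egfCoeff n := by
  rw [probWeaklyConnected_eq hn, connCoeff, egfCoeff,
    div_div_div_cancel_right₀ (by positivity)]

theorem isBigO_probWeaklyConnected_sub (r : ℕ) :
    (fun n => probWeaklyConnected n - ∑ k ∈ Icc 0 r, expansionTerm k n)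
      =O[atTop] expansionTerm (r + 1) := by
  obtain ⟨K, hK⟩ := LogarithmicExpansion.exists_error_le egfCoeff_mul_invCoeff
    connCoeff_mul_egfCoeff (fun n => (egfCoeff_pos n).le) (by simp [egfCoeff]) abs_connCoeff_le
    egfCoeff_tail r
  -- The bound is in terms of `egfCoeff (n - r - 1)`; the next term carries the extra factor
  -- `invCoeff (r + 1)`.
  refine IsBigO.of_bound (K / |invCoeff (r + 1)|) ?_
  filter_upwards [eventually_ge_atTop (2 * r + 2)] with n hn
  have h1 : probWeaklyConnected n - ∑ k ∈ Icc 0 r, expansionTerm k n =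
      LogarithmicExpansion.error egfCoeff connCoeff invCoeff r n / egfCoeff n := by
    rw [probWeaklyConnected_eq_div (by omega), LogarithmicExpansion.error, sub_div, sum_div,
      Nat.range_succ_eq_Icc_zero]
    congr 1
    refine sum_congr rfl fun k hk => expansionTerm_eq ?_
    rw [mem_Icc] at hk
    omega
  have hi : |invCoeff (r + 1)| ≠ 0 := abs_ne_zero.2 (invCoeff_ne_zero _)
  rw [h1, expansionTerm_eq (by omega), Real.norm_eq_abs, Real.norm_eq_abs, abs_div, abs_div,
    abs_mul, abs_of_pos (egfCoeff_pos n), abs_of_pos (egfCoeff_pos (n - (r + 1))),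
    ← mul_div_assoc, ← mul_assoc, div_mul_cancel₀ _ hi, ← Nat.sub_sub]
  exact div_le_div_of_nonneg_right (hK n hn) (egfCoeff_pos n).le

theorem isLittleO_egfCoeff :
    egfCoeff =o[atTop] fun n => egfCoeff (n + 1) := by
  rw [isLittleO_iff_tendsto fun n h => absurd h (egfCoeff_pos _).ne']
  have h1 : Tendsto (fun n : ℕ => (n : ℝ) * (1 / 3) ^ n + (1 / 3) ^ n) atTop (nhds (0 + 0)) :=
    (tendsto_self_mul_const_pow_of_lt_one (by norm_num) (by norm_num)).add
      (tendsto_pow_atTop_nhds_zero_of_lt_one (by norm_num) (by norm_num))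
  rw [add_zero] at h1
  -- The ratio of consecutive coefficients is `(n + 1) / 3 ^ n`.
  refine h1.congr fun n => ?_
  have h := egfCoeff_succ n
  have := (egfCoeff_pos n).ne'
  rw [eq_div_iff (egfCoeff_pos _).ne']
  have h3 : ((1 : ℝ) / 3) ^ n * 3 ^ n = 1 := by rw [← mul_pow]; norm_num
  linear_combination (1 / 3 : ℝ) ^ n * h + egfCoeff n * h3

theorem isLittleO_expansionTerm (k : ℕ) :
    expansionTerm (k + 1) =o[atTop] expansionTerm k := by
  have h1 : (fun n => egfCoeff (n - (k + 1))) =o[atTop] fun n => egfCoeff (n - k) := by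
    refine (isLittleO_egfCoeff.comp_tendsto (tendsto_sub_atTop_nat (k + 1))).congr'
      (EventuallyEq.refl _ _) ?_
    filter_upwards [eventually_ge_atTop (k + 1)] with n hn
    simp only [Function.comp]
    congr 1
    omega
  have h2 := ((h1.const_mul_left (invCoeff (k + 1))).const_mul_right
    (invCoeff_ne_zero k)).mul_isBigO (isBigO_refl (fun n => (egfCoeff n)⁻¹) atTop)
  refine h2.congr' ?_ ?_
  · filter_upwards [eventually_ge_atTop (k + 1)] with n hn
    rw [expansionTerm_eq hn, div_eq_mul_inv]
  · filter_upwards [eventually_ge_atTop k] with n hn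
    rw [expansionTerm_eq hn, div_eq_mul_inv]

end OrientedGraph

theorem mainTheorem5 :
    HasAsymptoticExpansion OrientedGraph.probWeaklyConnected 0
      (fun k n =>
        if k = 0 then 1
        else -((MultiTournament.irreducibleCount 2 k : ℝ) * (n.choose k : ℝ) *
          ((3 : ℝ) ^ (k * (k + 1) / 2) / (3 : ℝ) ^ (k * n)))) :=
  ⟨fun r _ => OrientedGraph.isBigO_probWeaklyConnected_sub r,
    fun k _ => OrientedGraph.isLittleO_expansionTerm k⟩
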